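/- All logarithms are to base $2$; $H(\mathbf p)=-\sum_{i=1}^n p_i\log p_i$ is the Shannon entropy of a probability distribution $\mathbf p$ on $[n]$, and $h(\epsilon)=-(1-\epsilon)\log(1-\epsilon)-\epsilon\log\epsilon$ is the binary entropy (with $0\log 0=0$). A quantum query algorithm has access to a unitary oracle $U$; each query is one use of $U$ or $U^\dagger$, possibly controlled by the workspace, queries are interleaved with arbitrary unitaries that do not depend on $U$, on a workspace of any finite dimension, and the output is a real number computed from a final measurement. We consider four input models for $\mathbf p$: (i) frequency vector of length $m$: $U|j\rangle|b\rangle=|j\rangle|b+v_j \bmod n\rangle$ for a string $v\in[n]^m$ with $p_i=|\{j: v_j=i\}|/m$; (ii) list of $m$ samples: the same oracle for a string $v\in[n]^m$ whose entries are drawn independently from $\mathbf p$; (iii) quantum samples: any unitary $U$ on $\mathbb C^n$ with $U|0\rangle=\sum_i\sqrt{p_i}\,|i\rangle$; (iv) purified access: any unitary $U$ on $\mathbb C^n\otimes\mathbb C^n$ with $U|0\rangle|0\rangle=\sum_i\sqrt{p_i}\,|\psi_i\rangle|i\rangle$ for some orthonormal $|\psi_1\rangle,\dots,|\psi_n\rangle$.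 For $\gamma>1$, say that an algorithm $\gamma$-estimates the entropy with success probability $s$ in one of these models if, for every $\mathbf p$ on $[n]$ that the model can represent and that satisfies $H(\mathbf p)>0$ and $H(\mathbf p)\ge h\bigl(\min\{1,\gamma^2/\log n\}\bigr)$, and for every oracle for $\mathbf p$ in that model (in model (ii): on average over the samples), the probability that its output $\tilde H$ satisfies $H(\mathbf p)/\gamma\le\tilde H\le\gamma H(\mathbf p)$ is at least $s$. **Theorem.** For every $s>1/2$ there is a constant $c>0$, depending only on $s$, such that for all $n\ge 2$ (for $n=1$ the bound is trivially $0$) and all $\gamma>1$, every algorithm that $\gamma$-estimates the entropy with success probability $s$ makes at least $c\,\sqrt{\log n}/\gamma$ queries, in each of the models (i)–(iv): in model (i) for every $m\ge m_0(n,\gamma)$, and in model (ii) for every $m$. In particular, in each of these models $\gamma$-multiplicative estimation of the Shannon entropy requires $\Omega(\sqrt{\log n}/\gamma)$ queries. -/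

import Mathlib

noncomputable section

/-- Shannon entropy, in bits, of `p = (p₁, …, pₙ)` (with `0 log 0 = 0`). -/
def shannonEntropy {n : ℕ} (p : Fin n → ℝ) : ℝ :=
  -∑ i, p i * Real.logb 2 (p i)

/-- What a query does in one branch of the workspace: nothing, apply the oracle `U`, or apply its
adjoint `U†`. -/
inductive QueryMode
  | idle
  | forward
  | adjoint

/-- The operator that a query in the given mode applies to the oracle register. -/
def QueryMode.toMatrix {Q : Type} [Fintype Q] [DecidableEq Q] (U : Matrix Q Q ℂ) :
    QueryMode → Matrix Q Q ℂ
  | idle => 1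
  | forward => U
  | adjoint => U.conjTranspose

/-- A quantum query algorithm with real-valued output, for oracles `U` acting on the register `ℂ^Q`.
It has a workspace register of any finite dimension `dim`, starts in a computational basis state,
alternates oracle-independent unitaries on both registers with `queries` queries, measures all of
its registers in the computational basis, and outputs a real number computed from the outcome.
Query number `t` applies `U`, `U†` or the identity to the oracle register according to the content
`w` of the workspace. Constant modes are plain uses of `U` and of `U†`; modes that are `idle` on
part of the workspace are controlled uses. Entries of `unitary` and `mode` past the last query are
never used. -/
structure QueryAlgorithm (Q : Type) [Fintype Q] [DecidableEq Q] where
  queries : ℕ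
  dim : ℕ
  start : Q × Fin dim
  unitary : ℕ → Matrix.unitaryGroup (Q × Fin dim) ℂ
  mode : ℕ → Fin dim → QueryMode
  output : Q × Fin dim → ℝ

namespace QueryAlgorithm

variable {Q : Type} [Fintype Q] [DecidableEq Q]

/-- Query number `t` as an operator on the oracle register and the workspace. -/
def queryMatrix (A : QueryAlgorithm Q) (U : Matrix Q Q ℂ) (t : ℕ) :
    Matrix (Q × Fin A.dim) (Q × Fin A.dim) ℂ :=
  Matrix.blockDiagonal fun w => (A.mode t w).toMatrix U

/-- The state of the algorithm, run with oracle `U`, after `t` queries (and the unitary that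
follows the last one of them). -/
def state (A : QueryAlgorithm Q) (U : Matrix Q Q ℂ) : ℕ → (Q × Fin A.dim → ℂ)
  | 0 => (A.unitary 0 : Matrix (Q × Fin A.dim) (Q × Fin A.dim) ℂ).mulVec (Pi.single A.start 1)
  | t + 1 => (A.unitary (t + 1) : Matrix (Q × Fin A.dim) (Q × Fin A.dim) ℂ).mulVec
      ((A.queryMatrix U t).mulVec (A.state U t))

open Classical in
/-- The probability that the algorithm, run with oracle `U`, outputs an estimate of `x` to within
the multiplicative factor `γ`, that is, a number in `[x / γ, γ x]`. -/
def estimateProb (A : QueryAlgorithm Q) (U : Matrix Q Q ℂ) (γ x : ℝ) : ℝ :=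
  ∑ z, if x / γ ≤ A.output z ∧ A.output z ≤ γ * x then ‖A.state U A.queries z‖ ^ 2 else 0

end QueryAlgorithm

/-- The standard oracle of a string `v ∈ [n]^m`: `|j⟩|b⟩ ↦ |j⟩|b + v_j mod n⟩`, so that
`|j⟩|0⟩ ↦ |j⟩|v_j⟩`. -/
def stringOracle {m n : ℕ} (v : Fin m → Fin n) : Matrix (Fin m × Fin n) (Fin m × Fin n) ℂ :=
  Matrix.of fun x y => if x.1 = y.1 ∧ x.2 = y.2 + v y.1 then 1 else 0

theorem stringOracle_mem_unitaryGroup {m n : ℕ} [NeZero n] (v : Fin m → Fin n) :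
    stringOracle v ∈ Matrix.unitaryGroup (Fin m × Fin n) ℂ := by
  rw [Matrix.mem_unitaryGroup_iff']
  ext ⟨j, b⟩ ⟨k, d⟩
  simp only [Matrix.mul_apply, Matrix.star_apply, stringOracle, Matrix.of_apply,
    Matrix.one_apply, Fintype.sum_prod_type, Prod.mk.injEq]
  rw [Finset.sum_eq_single j, Finset.sum_eq_single (b + v j)]
  · by_cases hjk : j = k
    · subst hjk
      simp
    · simp [hjk]
  · intro c _ hc
    simp [hc]
  · simp
  · intro l _ hl
    simp [hl]
  · simp

/-- The distribution that a frequency vector `v ∈ [n]^m` represents: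
`p_i = |{j : v_j = i}| / m`. -/
def frequency {m n : ℕ} (v : Fin m → Fin n) (i : Fin n) : ℝ :=
  ((Finset.univ.filter fun j => v j = i).card : ℝ) / m

/-- `U` prepares the quantum sample of `p`: `U|0⟩ = ∑ᵢ √pᵢ |i⟩`. -/
def PreparesQuantumSample {n : ℕ} [NeZero n] (p : Fin n → ℝ) (U : Matrix (Fin n) (Fin n) ℂ) :
    Prop :=
  U.mulVec (Pi.single 0 1) = fun i => (√(p i) : ℂ)

/-- `U` prepares a purification of `p`: `U|0⟩|0⟩ = ∑ᵢ √pᵢ |ψᵢ⟩|i⟩` for some orthonormal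
`ψ₁, …, ψₙ`. -/
def PreparesPurification {n : ℕ} [NeZero n] (p : Fin n → ℝ)
    (U : Matrix (Fin n × Fin n) (Fin n × Fin n) ℂ) : Prop :=
  ∃ ψ : Fin n → EuclideanSpace ℂ (Fin n), Orthonormal ℂ ψ ∧
    U.mulVec (Pi.single (0, 0) 1) = fun x => (√(p x.2) : ℂ) * ψ x.2 x.1

/-- The inputs on which an algorithm has to be correct: `H(p) > 0` and `H(p) ≥ h(ε)`, where
`ε = min(1, γ² / log n)` and `h(ε)` is the entropy of `(1 - ε, ε)`. -/
def Promise {n : ℕ} (γ : ℝ) (p : Fin n → ℝ) : Prop :=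
  0 < shannonEntropy p ∧
    shannonEntropy ![1 - min 1 (γ ^ 2 / Real.logb 2 n), min 1 (γ ^ 2 / Real.logb 2 n)]
      ≤ shannonEntropy p

/-- `A` estimates the entropy to within the factor `γ`, with probability at least `s`, given query
access to frequency vectors of length `m`. -/
def EstimatesFromFrequencyVector {m n : ℕ} (A : QueryAlgorithm (Fin m × Fin n)) (γ s : ℝ) :
    Prop :=
  ∀ v : Fin m → Fin n, Promise γ (frequency v) →
    s ≤ A.estimateProb (stringOracle v) γ (shannonEntropy (frequency v))

/-- `A` estimates the entropy to within the factor `γ`, given query access to a list of `m`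
independent samples from `p`; the success probability is over both the samples and the
measurement. -/
def EstimatesFromSampleList {m n : ℕ} (A : QueryAlgorithm (Fin m × Fin n)) (γ s : ℝ) : Prop :=
  ∀ p ∈ stdSimplex ℝ (Fin n), Promise γ p →
    s ≤ ∑ v : Fin m → Fin n,
      (∏ j, p (v j)) * A.estimateProb (stringOracle v) γ (shannonEntropy p)

/-- `A` estimates the entropy to within the factor `γ`, given any unitary that prepares the quantum
sample of `p`. -/
def EstimatesFromQuantumSamples {n : ℕ} [NeZero n] (A : QueryAlgorithm (Fin n)) (γ s : ℝ) :
    Prop :=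
  ∀ p ∈ stdSimplex ℝ (Fin n), Promise γ p →
    ∀ U ∈ Matrix.unitaryGroup (Fin n) ℂ, PreparesQuantumSample p U →
      s ≤ A.estimateProb U γ (shannonEntropy p)

/-- `A` estimates the entropy to within the factor `γ`, given any unitary that prepares a
purification of `p`. -/
def EstimatesFromPurification {n : ℕ} [NeZero n] (A : QueryAlgorithm (Fin n × Fin n)) (γ s : ℝ) :
    Prop :=
  ∀ p ∈ stdSimplex ℝ (Fin n), Promise γ p →
    ∀ U ∈ Matrix.unitaryGroup (Fin n × Fin n) ℂ, PreparesPurification p U →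
      s ≤ A.estimateProb U γ (shannonEntropy p)

end

/-!
An oracle whose (random) unitary moves every state by at most `√D` in quadratic mean cannot be told
apart from the identity oracle with few queries: by the hybrid argument, `T` queries shift the
acceptance probability of any event by at most `2 T √D`. If the entropies of two distributions
differ by more than a factor `γ ^ 2`, no output is a correct estimate for both, so an algorithm that
is correct on two such distributions needs `T = Ω(1 / √D)` queries.

Two such distributions, both satisfying the promise, exist within `ε = O(γ ^ 2 / log n)` of the
point mass at `0`: on the segment from the point mass to the uniform distribution the entropy at
distance `ε` is at least `ε log n`. In every model a distribution with `1 - p 0 ≤ ε` has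
an oracle with `D = O(ε)`. For samples, and for a randomly shifted frequency vector, each position
of the string differs from `0` with probability at most `ε`. For state preparation, the rotation in
the plane of `|0⟩` and the target state `|u⟩` moves no unit vector farther than it moves `|0⟩`, and
`⟨0|u⟩ = √p₀ ≥ p₀`.
-/

open Filter Finset Matrix Topology
open scoped InnerProductSpace

section Amplitudes

variable {ι : Type*} [Fintype ι]

theorem norm_toEuclideanCLM_apply [DecidableEq ι] {U : Matrix ι ι ℂ} (hU : U ∈ unitaryGroup ι ℂ)
    (f : EuclideanSpace ℂ ι) : ‖toEuclideanCLM (𝕜 := ℂ) U f‖ = ‖f‖ :=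
  ContinuousLinearMap.norm_map_of_mem_unitary (Unitary.map_mem toEuclideanCLM hU) f

theorem exists_mem_unitaryGroup_toEuclideanCLM_eq [DecidableEq ι]
    (R : EuclideanSpace ℂ ι ≃ₗᵢ[ℂ] EuclideanSpace ℂ ι) :
    ∃ U ∈ unitaryGroup ι ℂ, ∀ f, toEuclideanCLM (𝕜 := ℂ) U f = R f := by
  have hR : (R : EuclideanSpace ℂ ι →L[ℂ] EuclideanSpace ℂ ι) ∈ unitary _ :=
    Unitary.coe_symm_linearIsometryEquiv_apply R ▸ (Unitary.linearIsometryEquiv.symm R).2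
  obtain ⟨U, hU⟩ := EquivLike.surjective (toEuclideanCLM (n := ι) (𝕜 := ℂ))
    (R : EuclideanSpace ℂ ι →L[ℂ] EuclideanSpace ℂ ι)
  refine ⟨U, mem_unitaryGroup_iff'.2 (EquivLike.injective (toEuclideanCLM (𝕜 := ℂ)) ?_),
    fun f => by rw [hU]; rfl⟩
  rw [map_mul, map_star, map_one, hU, Unitary.star_mul_self_of_mem hR]

/-- The probability that measuring `f` in the computational basis gives an outcome in `S`. -/
noncomputable def outcomeProb (S : Set ι) (f : EuclideanSpace ℂ ι) : ℝ :=
  ∑ z, S.indicator (fun z => ‖f z‖ ^ 2) z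

theorem outcomeProb_add_le_norm_sq {S T : Set ι} (hST : Disjoint S T) (f : EuclideanSpace ℂ ι) :
    outcomeProb S f + outcomeProb T f ≤ ‖f‖ ^ 2 := by
  rw [outcomeProb, outcomeProb, ← sum_add_distrib, EuclideanSpace.norm_sq_eq]
  refine sum_le_sum fun z _ => ?_
  refine (congrFun (Set.indicator_union_of_disjoint hST fun z => ‖f z‖ ^ 2) z).symm.trans_le ?_
  exact Set.indicator_le_self' (fun _ _ => by positivity) z

theorem outcomeProb_sub_le (S : Set ι) (f g : EuclideanSpace ℂ ι) :
    outcomeProb S f - outcomeProb S g ≤ ‖f - g‖ * (‖f‖ + ‖g‖) := by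
  have cauchySchwarz (h : EuclideanSpace ℂ ι) :
      ∑ z, ‖(f - g) z‖ * ‖h z‖ ≤ ‖f - g‖ * ‖h‖ := by
    simpa only [EuclideanSpace.norm_eq] using
      Real.sum_mul_le_sqrt_mul_sqrt univ (fun z => ‖(f - g) z‖) fun z => ‖h z‖
  have pointwise (z : ι) : ‖f z‖ ^ 2 - ‖g z‖ ^ 2 ≤ ‖(f - g) z‖ * (‖f z‖ + ‖g z‖) := by
    rw [sq_sub_sq, mul_comm]
    gcongr
    exact norm_sub_norm_le (f z) (g z)
  calc outcomeProb S f - outcomeProb S g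
      = ∑ z, S.indicator (fun z => ‖f z‖ ^ 2 - ‖g z‖ ^ 2) z := by
        simp only [outcomeProb, ← sum_sub_distrib, Set.indicator_sub]
    _ ≤ ∑ z, ‖(f - g) z‖ * (‖f z‖ + ‖g z‖) :=
        sum_le_sum fun z _ => Set.indicator_apply_le' (fun _ => pointwise z) fun _ => by positivity
    _ ≤ ‖f - g‖ * (‖f‖ + ‖g‖) := by
        simp only [mul_add, sum_add_distrib]
        exact add_le_add (cauchySchwarz f) (cauchySchwarz g)

/-- The component of a joint state of a register and a workspace in which the workspace holds `w`
(not normalised). -/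
def branch {κ : Type*} (f : EuclideanSpace ℂ (ι × κ)) (w : κ) : EuclideanSpace ℂ ι :=
  WithLp.toLp 2 fun q => f (q, w)

theorem norm_sq_eq_sum_branch {κ : Type*} [Fintype κ] (f : EuclideanSpace ℂ (ι × κ)) :
    ‖f‖ ^ 2 = ∑ w, ‖branch f w‖ ^ 2 := by
  simp only [EuclideanSpace.norm_sq_eq, Fintype.sum_prod_type_right, branch]

theorem branch_toEuclideanCLM_blockDiagonal {κ : Type*} [Fintype κ] [DecidableEq ι] [DecidableEq κ]
    (M : κ → Matrix ι ι ℂ) (f : EuclideanSpace ℂ (ι × κ)) (w : κ) :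
    branch (toEuclideanCLM (𝕜 := ℂ) (blockDiagonal M) f) w =
      toEuclideanCLM (𝕜 := ℂ) (M w) (branch f w) := by
  ext q
  simp [branch, mulVec, dotProduct, blockDiagonal_apply, Fintype.sum_prod_type, ite_mul]

end Amplitudes

theorem blockDiagonal_mem_unitaryGroup {ι κ α : Type*} [Fintype ι] [DecidableEq ι] [Fintype κ]
    [DecidableEq κ] [CommRing α] [StarRing α] {M : κ → Matrix ι ι α}
    (hM : ∀ w, M w ∈ unitaryGroup ι α) : blockDiagonal M ∈ unitaryGroup (ι × κ) α := by
  have h : (fun w => M w * (M w)ᴴ) = 1 := funext fun w => mem_unitaryGroup_iff.1 (hM w)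
  rw [mem_unitaryGroup_iff, star_eq_conjTranspose, blockDiagonal_conjTranspose,
    ← blockDiagonal_mul, h, blockDiagonal_one]

namespace QueryMode

variable {Q : Type} [Fintype Q] [DecidableEq Q] {U : Matrix Q Q ℂ}

theorem toMatrix_mem_unitaryGroup (hU : U ∈ unitaryGroup Q ℂ) (μ : QueryMode) :
    μ.toMatrix U ∈ unitaryGroup Q ℂ := by
  cases μ
  exacts [one_mem _, hU, Unitary.star_mem hU]

theorem toMatrix_one (μ : QueryMode) : μ.toMatrix (1 : Matrix Q Q ℂ) = 1 := by
  cases μ <;> simp [toMatrix]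

theorem norm_toMatrix_sub_one_le (hU : U ∈ unitaryGroup Q ℂ) (μ : QueryMode)
    (f : EuclideanSpace ℂ Q) :
    ‖toEuclideanCLM (𝕜 := ℂ) (μ.toMatrix U - 1) f‖ ≤ ‖toEuclideanCLM (𝕜 := ℂ) (U - 1) f‖ := by
  cases μ
  case idle => simp [toMatrix]
  case forward => rfl
  case adjoint =>
    have h : Uᴴ - 1 = -(star U * (U - 1)) := by
      rw [mul_sub, mem_unitaryGroup_iff'.1 hU, mul_one, neg_sub, star_eq_conjTranspose]
    rw [toMatrix, h, map_neg, map_mul, _root_.neg_apply, norm_neg,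
      mul_apply_eq_comp, norm_toEuclideanCLM_apply (Unitary.star_mem hU)]

end QueryMode

namespace QueryAlgorithm

variable {Q : Type} [Fintype Q] [DecidableEq Q] (A : QueryAlgorithm Q) {U : Matrix Q Q ℂ}

theorem queryMatrix_mem_unitaryGroup (hU : U ∈ unitaryGroup Q ℂ) (t : ℕ) :
    A.queryMatrix U t ∈ unitaryGroup (Q × Fin A.dim) ℂ :=
  blockDiagonal_mem_unitaryGroup fun w => (A.mode t w).toMatrix_mem_unitaryGroup hU

theorem norm_sq_queryMatrix_sub_le (hU : U ∈ unitaryGroup Q ℂ) (t : ℕ)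
    (f : EuclideanSpace ℂ (Q × Fin A.dim)) :
    ‖toEuclideanCLM (𝕜 := ℂ) (A.queryMatrix U t - A.queryMatrix 1 t) f‖ ^ 2 ≤
      ∑ w, ‖toEuclideanCLM (𝕜 := ℂ) (U - 1) (branch f w)‖ ^ 2 := by
  rw [queryMatrix, queryMatrix, ← blockDiagonal_sub, norm_sq_eq_sum_branch]
  gcongr with w
  rw [branch_toEuclideanCLM_blockDiagonal, Pi.sub_apply, QueryMode.toMatrix_one]
  exact (A.mode t w).norm_toMatrix_sub_one_le hU _

/-- The state after `t` queries as a vector in Euclidean space: a plain function would carry the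
supremum norm. -/
noncomputable def stateVector (A : QueryAlgorithm Q) (U : Matrix Q Q ℂ) (t : ℕ) :
    EuclideanSpace ℂ (Q × Fin A.dim) :=
  WithLp.toLp 2 (A.state U t)

theorem stateVector_zero (U : Matrix Q Q ℂ) : A.stateVector U 0 =
    toEuclideanCLM (𝕜 := ℂ) (A.unitary 0) (EuclideanSpace.single A.start 1) :=
  rfl

theorem stateVector_succ (U : Matrix Q Q ℂ) (t : ℕ) : A.stateVector U (t + 1) =
    toEuclideanCLM (𝕜 := ℂ) (A.unitary (t + 1))
      (toEuclideanCLM (𝕜 := ℂ) (A.queryMatrix U t) (A.stateVector U t)) :=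
  rfl

theorem norm_stateVector (hU : U ∈ unitaryGroup Q ℂ) (t : ℕ) : ‖A.stateVector U t‖ = 1 := by
  induction t with
  | zero => rw [stateVector_zero, norm_toEuclideanCLM_apply (A.unitary 0).2]; simp
  | succ t ih =>
    rw [stateVector_succ, norm_toEuclideanCLM_apply (A.unitary (t + 1)).2,
      norm_toEuclideanCLM_apply (A.queryMatrix_mem_unitaryGroup hU t), ih]

/-- The hybrid argument: exchanging the oracle `V` for `U` in the `i`-th query alone moves the final
state as far as it moves the state at that query. -/
theorem norm_stateVector_sub_le (hU : U ∈ unitaryGroup Q ℂ) (V : Matrix Q Q ℂ) (t : ℕ) :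
    ‖A.stateVector U t - A.stateVector V t‖ ≤ ∑ i ∈ range t,
      ‖toEuclideanCLM (𝕜 := ℂ) (A.queryMatrix U i - A.queryMatrix V i) (A.stateVector V i)‖ := by
  induction t with
  | zero => simp [stateVector_zero]
  | succ t ih =>
    have split : A.stateVector U (t + 1) - A.stateVector V (t + 1) =
        toEuclideanCLM (𝕜 := ℂ) (A.unitary (t + 1))
          (toEuclideanCLM (𝕜 := ℂ) (A.queryMatrix U t) (A.stateVector U t - A.stateVector V t) +
            toEuclideanCLM (𝕜 := ℂ) (A.queryMatrix U t - A.queryMatrix V t)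
              (A.stateVector V t)) := by
      rw [stateVector_succ, stateVector_succ, ← map_sub]
      simp
    rw [split, norm_toEuclideanCLM_apply (A.unitary (t + 1)).2, sum_range_succ]
    refine (norm_add_le _ _).trans ?_
    rw [norm_toEuclideanCLM_apply (A.queryMatrix_mem_unitaryGroup hU t)]
    gcongr

theorem estimateProb_eq_outcomeProb (U : Matrix Q Q ℂ) (γ x : ℝ) :
    A.estimateProb U γ x =
      outcomeProb {z | x / γ ≤ A.output z ∧ A.output z ≤ γ * x} (A.stateVector U A.queries) := by
  classical
  simp only [estimateProb, outcomeProb, Set.indicator_apply, Set.mem_ofPred_eq, stateVector]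

theorem estimateProb_add_estimateProb_le_one (hU : U ∈ unitaryGroup Q ℂ) {γ x y : ℝ} (hγ : 0 < γ)
    (hxy : γ ^ 2 * x < y) : A.estimateProb U γ x + A.estimateProb U γ y ≤ 1 := by
  have hdisj : Disjoint {z | x / γ ≤ A.output z ∧ A.output z ≤ γ * x}
      {z | y / γ ≤ A.output z ∧ A.output z ≤ γ * y} := by
    rw [Set.disjoint_left]
    rintro z ⟨-, hx⟩ ⟨hy, -⟩
    rw [div_le_iff₀ hγ] at hy
    nlinarith
  simpa only [estimateProb_eq_outcomeProb, A.norm_stateVector hU, one_pow] using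
    outcomeProb_add_le_norm_sq hdisj (A.stateVector U A.queries)

theorem estimateProb_sub_le {V : Matrix Q Q ℂ} (hU : U ∈ unitaryGroup Q ℂ)
    (hV : V ∈ unitaryGroup Q ℂ) (γ x : ℝ) :
    A.estimateProb U γ x - A.estimateProb V γ x ≤ 2 * ∑ t ∈ range A.queries,
      ‖toEuclideanCLM (𝕜 := ℂ) (A.queryMatrix U t - A.queryMatrix V t) (A.stateVector V t)‖ := by
  rw [estimateProb_eq_outcomeProb, estimateProb_eq_outcomeProb]
  refine (outcomeProb_sub_le _ _ _).trans ?_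
  rw [A.norm_stateVector hU, A.norm_stateVector hV, one_add_one_eq_two, mul_comm]
  gcongr
  exact A.norm_stateVector_sub_le hU V _

end QueryAlgorithm

/-- The random oracle that is `U i` with probability `w i` moves every state by at most `√D` in
quadratic mean. -/
structure IsNearIdentity {Q ι : Type*} [Fintype Q] [DecidableEq Q] [Fintype ι] (w : ι → ℝ)
    (U : ι → Matrix Q Q ℂ) (D : ℝ) : Prop where
  weight_mem : w ∈ stdSimplex ℝ ι
  unitary (i : ι) : U i ∈ unitaryGroup Q ℂ
  deviation (f : EuclideanSpace ℂ Q) :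
    ∑ i, w i * ‖toEuclideanCLM (𝕜 := ℂ) (U i - 1) f‖ ^ 2 ≤ D * ‖f‖ ^ 2

namespace IsNearIdentity

variable {Q : Type} {ι : Type*} [Fintype Q] [DecidableEq Q] [Fintype ι] {w : ι → ℝ}
  {U : ι → Matrix Q Q ℂ} {D : ℝ}

theorem mono (h : IsNearIdentity w U D) {D' : ℝ} (hD : D ≤ D') : IsNearIdentity w U D' :=
  ⟨h.weight_mem, h.unitary, fun f => (h.deviation f).trans (by gcongr)⟩

theorem sum_norm_sq_queryMatrix_sub_le (h : IsNearIdentity w U D) (A : QueryAlgorithm Q) (t : ℕ)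
    (f : EuclideanSpace ℂ (Q × Fin A.dim)) :
    ∑ i, w i * ‖toEuclideanCLM (𝕜 := ℂ) (A.queryMatrix (U i) t - A.queryMatrix 1 t) f‖ ^ 2 ≤
      D * ‖f‖ ^ 2 :=
  calc ∑ i, w i * ‖toEuclideanCLM (𝕜 := ℂ) (A.queryMatrix (U i) t - A.queryMatrix 1 t) f‖ ^ 2
      ≤ ∑ i, w i * ∑ b, ‖toEuclideanCLM (𝕜 := ℂ) (U i - 1) (branch f b)‖ ^ 2 :=
        sum_le_sum fun i _ => mul_le_mul_of_nonneg_left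
          (A.norm_sq_queryMatrix_sub_le (h.unitary i) t f) (h.weight_mem.1 i)
    _ = ∑ b, ∑ i, w i * ‖toEuclideanCLM (𝕜 := ℂ) (U i - 1) (branch f b)‖ ^ 2 := by
        simp only [mul_sum]
        exact sum_comm
    _ ≤ ∑ b, D * ‖branch f b‖ ^ 2 := sum_le_sum fun b _ => h.deviation _
    _ = D * ‖f‖ ^ 2 := by rw [← mul_sum, ← norm_sq_eq_sum_branch]

theorem sum_norm_queryMatrix_sub_le (h : IsNearIdentity w U D) (A : QueryAlgorithm Q) (t : ℕ)
    {f : EuclideanSpace ℂ (Q × Fin A.dim)} (hf : ‖f‖ = 1) :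
    ∑ i, w i * ‖toEuclideanCLM (𝕜 := ℂ) (A.queryMatrix (U i) t - A.queryMatrix 1 t) f‖ ≤ √D := by
  refine Real.le_sqrt_of_sq_le ((Real.pow_arith_mean_le_arith_mean_pow univ w _
    (fun i _ => h.weight_mem.1 i) h.weight_mem.2 (fun i _ => norm_nonneg _) 2).trans ?_)
  simpa only [hf, one_pow, mul_one] using h.sum_norm_sq_queryMatrix_sub_le A t f

theorem sum_estimateProb_le (h : IsNearIdentity w U D) (A : QueryAlgorithm Q) (γ x : ℝ) :
    ∑ i, w i * A.estimateProb (U i) γ x ≤ A.estimateProb 1 γ x + 2 * (A.queries * √D) := by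
  set δ : ι → ℕ → ℝ := fun i t => ‖toEuclideanCLM (𝕜 := ℂ)
    (A.queryMatrix (U i) t - A.queryMatrix 1 t) (A.stateVector 1 t)‖
  calc ∑ i, w i * A.estimateProb (U i) γ x
      ≤ ∑ i, w i * (A.estimateProb 1 γ x + 2 * ∑ t ∈ range A.queries, δ i t) := by
        gcongr with i
        · exact h.weight_mem.1 i
        · exact sub_le_iff_le_add'.1 (A.estimateProb_sub_le (h.unitary i) (one_mem _) γ x)
    _ = A.estimateProb 1 γ x + 2 * ∑ t ∈ range A.queries, ∑ i, w i * δ i t := by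
        simp only [mul_add, sum_add_distrib, ← sum_mul, h.weight_mem.2, one_mul,
          mul_left_comm _ (2 : ℝ), ← mul_sum]
        rw [sum_comm]
        simp only [mul_sum]
    _ ≤ A.estimateProb 1 γ x + 2 * ∑ _t ∈ range A.queries, √D := by
        gcongr with t
        exact h.sum_norm_queryMatrix_sub_le A t (A.norm_stateVector (one_mem _) t)
    _ = A.estimateProb 1 γ x + 2 * (A.queries * √D) := by
        rw [sum_const, card_range, nsmul_eq_mul]

theorem two_mul_le_of_le_sum_estimateProb {κ : Type*} [Fintype κ] {w' : κ → ℝ}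
    {U' : κ → Matrix Q Q ℂ} (h : IsNearIdentity w U D) (h' : IsNearIdentity w' U' D)
    (A : QueryAlgorithm Q) {γ x y s : ℝ} (hγ : 0 < γ) (hxy : γ ^ 2 * x < y)
    (hx : s ≤ ∑ i, w i * A.estimateProb (U i) γ x)
    (hy : s ≤ ∑ i, w' i * A.estimateProb (U' i) γ y) :
    2 * s ≤ 1 + 4 * (A.queries * √D) := by
  linarith [h.sum_estimateProb_le A γ x, h'.sum_estimateProb_le A γ y,
    A.estimateProb_add_estimateProb_le_one (one_mem _) hγ hxy]

end IsNearIdentity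

theorem sum_prod_mul_apply {ι κ R : Type*} [Fintype ι] [DecidableEq ι] [Fintype κ]
    [CommSemiring R] {p : κ → R} (hp : ∑ i, p i = 1) (g : κ → R) (j : ι) :
    ∑ v : ι → κ, (∏ k, p (v k)) * g (v j) = ∑ i, p i * g i := by
  have factor (v : ι → κ) : (∏ k, p (v k)) * g (v j) =
      ∏ k, p (v k) * (if k = j then g (v k) else 1) := by
    rw [prod_mul_distrib, Fintype.prod_ite_eq' j fun k => g (v k)]
  simp only [factor]
  rw [← Fintype.prod_sum fun k i => p i * (if k = j then g i else 1), Fintype.prod_eq_single j]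
  · simp only [if_true]
  · intro k hk
    simp only [if_neg hk, mul_one, hp]

theorem frequency_comp_equiv {m n : ℕ} (v : Fin m → Fin n) (e : Fin m ≃ Fin m) :
    frequency (v ∘ e) = frequency v := by
  ext i
  simp only [frequency]
  congr 2
  exact card_equiv e (by simp)

theorem sum_frequency {m n : ℕ} [NeZero m] (v : Fin m → Fin n) : ∑ i, frequency v i = 1 := by
  have hm : (m : ℝ) ≠ 0 := NeZero.ne _
  simp only [frequency]
  rw [← sum_div, div_eq_one_iff_eq hm, ← Nat.cast_sum,
    ← card_eq_sum_card_fiberwise fun j _ => mem_coe.2 (mem_univ (v j)), card_univ, Fintype.card_fin]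

theorem frequency_mem_stdSimplex {m n : ℕ} [NeZero m] (v : Fin m → Fin n) :
    frequency v ∈ stdSimplex ℝ (Fin n) :=
  ⟨fun i => by unfold frequency; positivity, sum_frequency v⟩

theorem sum_filter_ne_one_div {m n : ℕ} [NeZero m] (v : Fin m → Fin n) (i : Fin n) :
    ∑ j with v j ≠ i, (1 / m : ℝ) = 1 - frequency v i := by
  have hm : (m : ℝ) ≠ 0 := NeZero.ne _
  rw [eq_sub_iff_add_eq', frequency, div_eq_mul_one_div, ← nsmul_eq_mul, ← sum_const,
    sum_filter_add_sum_filter_not]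
  simp [hm]

section StringOracle

variable {m n : ℕ} [NeZero n]

theorem stringOracle_mulVec_apply (v : Fin m → Fin n) (f : Fin m × Fin n → ℂ) (j : Fin m)
    (b : Fin n) : (stringOracle v *ᵥ f) (j, b) = f (j, b - v j) := by
  have h (y : Fin m × Fin n) : j = y.1 ∧ b = y.2 + v y.1 ↔ (j, b - v j) = y := by
    rw [Prod.ext_iff, sub_eq_iff_eq_add]
    exact and_congr_right fun hj => by rw [hj]
  simp only [mulVec, dotProduct, stringOracle, of_apply, h, ite_mul, one_mul, zero_mul,
    Fintype.sum_ite_eq]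

theorem norm_sq_stringOracle_sub_one_le (v : Fin m → Fin n) (f : EuclideanSpace ℂ (Fin m × Fin n)) :
    ‖toEuclideanCLM (𝕜 := ℂ) (stringOracle v - 1) f‖ ^ 2 ≤
      ∑ j with v j ≠ 0, 4 * ∑ b, ‖f (j, b)‖ ^ 2 := by
  rw [EuclideanSpace.norm_sq_eq, Fintype.sum_prod_type, sum_filter]
  refine sum_le_sum fun j _ => ?_
  simp only [ofLp_toEuclideanCLM, sub_mulVec, one_mulVec, Pi.sub_apply, stringOracle_mulVec_apply]
  split_ifs with hj
  · have shift : ∑ b, ‖f (j, b - v j)‖ ^ 2 = ∑ b, ‖f (j, b)‖ ^ 2 :=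
      (Equiv.subRight (v j)).sum_comp fun b => ‖f (j, b)‖ ^ 2
    calc ∑ b, ‖f (j, b - v j) - f (j, b)‖ ^ 2
        ≤ ∑ b, 2 * (‖f (j, b - v j)‖ ^ 2 + ‖f (j, b)‖ ^ 2) := by
          gcongr with b
          exact (pow_le_pow_left₀ (norm_nonneg _) (norm_sub_le _ _) 2).trans add_sq_le
      _ = 4 * ∑ b, ‖f (j, b)‖ ^ 2 := by
          rw [← mul_sum, sum_add_distrib, shift]
          ring
  · simp [not_not.1 hj]

theorem isNearIdentity_stringOracle {ι : Type*} [Fintype ι] {w : ι → ℝ} (hw : w ∈ stdSimplex ℝ ι)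
    (v : ι → Fin m → Fin n) {σ : ℝ} (h : ∀ j, ∑ i with v i j ≠ 0, w i ≤ σ) :
    IsNearIdentity w (fun i => stringOracle (v i)) (4 * σ) where
  weight_mem := hw
  unitary i := stringOracle_mem_unitaryGroup (v i)
  deviation f :=
    calc ∑ i, w i * ‖toEuclideanCLM (𝕜 := ℂ) (stringOracle (v i) - 1) f‖ ^ 2
        ≤ ∑ i, w i * ∑ j with v i j ≠ 0, 4 * ∑ b, ‖f (j, b)‖ ^ 2 :=
          sum_le_sum fun i _ => mul_le_mul_of_nonneg_left
            (norm_sq_stringOracle_sub_one_le (v i) f) (hw.1 i)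
      _ = ∑ j, (∑ i with v i j ≠ 0, w i) * (4 * ∑ b, ‖f (j, b)‖ ^ 2) := by
          simp only [mul_sum _ _ (w _), sum_mul]
          exact sum_comm' fun i j => by simp
      _ ≤ ∑ j, σ * (4 * ∑ b, ‖f (j, b)‖ ^ 2) := by
          gcongr with j
          exact h j
      _ = 4 * σ * ‖f‖ ^ 2 := by
          rw [EuclideanSpace.norm_sq_eq, Fintype.sum_prod_type, ← mul_sum, ← mul_sum]
          ring

theorem isNearIdentity_sampleList {p : Fin n → ℝ} (hp : p ∈ stdSimplex ℝ (Fin n)) :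
    IsNearIdentity (fun v : Fin m → Fin n => ∏ j, p (v j)) stringOracle (4 * (1 - p 0)) := by
  refine isNearIdentity_stringOracle ⟨fun v => prod_nonneg fun j _ => hp.1 _, ?_⟩ (fun v => v) ?_
  · rw [← Fintype.prod_sum fun _ => p, prod_eq_one fun _ _ => hp.2]
  · intro j
    have marginal := sum_prod_mul_apply hp.2 (fun i => if i ≠ 0 then 1 else 0) j
    simp only [mul_ite, mul_one, mul_zero, ← sum_filter] at marginal
    rw [marginal, filter_ne' univ (0 : Fin n), sum_erase_eq_sub (mem_univ _), hp.2]

/-- Querying the string at a uniformly random cyclic shift spreads its zeros evenly over the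
positions. -/
theorem isNearIdentity_shift [NeZero m] (v : Fin m → Fin n) :
    IsNearIdentity (fun _ : Fin m => (1 / m : ℝ))
      (fun r => stringOracle (v ∘ Equiv.addRight r)) (4 * (1 - frequency v 0)) := by
  refine isNearIdentity_stringOracle ⟨fun _ => by positivity, by simp⟩ _ fun j => ?_
  rw [← frequency_comp_equiv v (Equiv.addLeft j), ← sum_filter_ne_one_div]
  rfl

end StringOracle

section Rotation

variable {𝕜 E : Type*} [RCLike 𝕜] [NormedAddCommGroup E] [InnerProductSpace 𝕜 E]

theorem norm_sq_starProjection_sub_le (K L : Submodule 𝕜 E) [K.HasOrthogonalProjection]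
    [L.HasOrthogonalProjection] {δ : ℝ} (hL : ∀ x ∈ L, ‖Kᗮ.starProjection x‖ ^ 2 ≤ δ * ‖x‖ ^ 2)
    (hLo : ∀ x ∈ Lᗮ, ‖K.starProjection x‖ ^ 2 ≤ δ * ‖x‖ ^ 2) (f : E) :
    ‖L.starProjection f - K.starProjection f‖ ^ 2 ≤ δ * ‖f‖ ^ 2 := by
  have hK : K.starProjection (L.starProjection f - K.starProjection f) =
      -K.starProjection (Lᗮ.starProjection f) := by
    rw [Submodule.starProjection_orthogonal_val, map_sub, map_sub, neg_sub,
      Submodule.starProjection_eq_self_iff.2 (K.starProjection_apply_mem f)]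
  have hKo : Kᗮ.starProjection (L.starProjection f - K.starProjection f) =
      Kᗮ.starProjection (L.starProjection f) := by
    rw [map_sub, Submodule.starProjection_orthogonal_val (K := K) (K.starProjection f),
      Submodule.starProjection_eq_self_iff.2 (K.starProjection_apply_mem f), sub_self, sub_zero]
  rw [K.norm_sq_eq_add_norm_sq_starProjection, hK, hKo, norm_neg,
    L.norm_sq_eq_add_norm_sq_starProjection f, mul_add, add_comm]
  exact add_le_add (hL _ (L.starProjection_apply_mem f)) (hLo _ (Lᗮ.starProjection_apply_mem f))

theorem norm_reflection_reflection_sub (K L : Submodule 𝕜 E) [K.HasOrthogonalProjection]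
    [L.HasOrthogonalProjection] (f : E) :
    ‖L.reflection (K.reflection f) - f‖ = 2 * ‖L.starProjection f - K.starProjection f‖ := by
  rw [← L.reflection.norm_map, map_sub, Submodule.reflection_reflection,
    Submodule.reflection_apply, Submodule.reflection_apply, sub_sub_sub_cancel_right, ← smul_sub,
    ← Nat.cast_smul_eq_nsmul 𝕜, norm_smul, norm_sub_rev]
  simp

section UnitVectors

variable {e u : E} {c : ℝ} (he : ‖e‖ = 1) (hu : ‖u‖ = 1) (hc : ⟪e, u⟫_𝕜 = c)

include he hu hc

theorem norm_sq_starProjection_orthogonal_span_le {x : E} (hx : x ∈ 𝕜 ∙ (e + u)) :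
    ‖(𝕜 ∙ e)ᗮ.starProjection x‖ ^ 2 ≤ (1 - c) / 2 * ‖x‖ ^ 2 := by
  obtain ⟨a, rfl⟩ := Submodule.mem_span_singleton.1 hx
  have hs : ‖e + u‖ ^ 2 = 2 * (1 + c) := by
    rw [norm_add_sq (𝕜 := 𝕜), hc, he, hu, RCLike.ofReal_re]
    ring
  have hp : ‖(𝕜 ∙ e).starProjection (e + u)‖ = |1 + c| := by
    rw [Submodule.starProjection_unit_singleton 𝕜 he, inner_add_right, hc,
      inner_self_eq_norm_sq_to_K, he, norm_smul, he, mul_one,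
      ← RCLike.ofReal_pow, one_pow, ← RCLike.ofReal_add, RCLike.norm_ofReal]
  have hpo := (𝕜 ∙ e).norm_sq_eq_add_norm_sq_starProjection (e + u)
  rw [hs, hp, sq_abs] at hpo
  rw [map_smul, norm_smul, norm_smul, mul_pow, mul_pow, hs, ← sub_eq_iff_eq_add'.2 hpo]
  exact le_of_eq (by ring)

theorem norm_sq_starProjection_span_le {x : E} (hx : x ∈ (𝕜 ∙ (e + u))ᗮ) :
    ‖(𝕜 ∙ e).starProjection x‖ ^ 2 ≤ (1 - c) / 2 * ‖x‖ ^ 2 := by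
  have hd : ‖e - u‖ ^ 2 = 2 * (1 - c) := by
    rw [norm_sub_sq (𝕜 := 𝕜), hc, he, hu, RCLike.ofReal_re]
    ring
  have hi : ⟪e - u, x⟫_𝕜 = 2 * ⟪e, x⟫_𝕜 := by
    have := Submodule.mem_orthogonal_singleton_iff_inner_right.1 hx
    rw [inner_add_left] at this
    rw [inner_sub_left]
    linear_combination -this
  have hcs : 2 * ‖⟪e, x⟫_𝕜‖ ≤ ‖e - u‖ * ‖x‖ := by
    simpa only [hi, norm_mul, RCLike.norm_ofNat] using norm_inner_le_norm (𝕜 := 𝕜) (e - u) x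
  rw [Submodule.starProjection_unit_singleton 𝕜 he, norm_smul, he, mul_one]
  calc ‖⟪e, x⟫_𝕜‖ ^ 2 = (2 * ‖⟪e, x⟫_𝕜‖) ^ 2 / 4 := by ring
    _ ≤ (‖e - u‖ * ‖x‖) ^ 2 / 4 := by gcongr
    _ = (1 - c) / 2 * ‖x‖ ^ 2 := by
      rw [mul_pow, hd]
      ring

end UnitVectors

variable (𝕜) in
/-- The rotation in the plane of two unit vectors `e` and `u` that moves `e` towards `u`, as the
product of two reflections. It is the identity on the orthogonal complement of this plane. -/
noncomputable def planeRotation (e u : E) : E ≃ₗᵢ[𝕜] E :=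
  (𝕜 ∙ e).reflection.trans (𝕜 ∙ (e + u)).reflection

theorem planeRotation_apply_self {e u : E} (hue : ‖e‖ = ‖u‖) {c : ℝ} (hc : ⟪e, u⟫_𝕜 = c) :
    planeRotation 𝕜 e u e = u := by
  have hadd : (𝕜 ∙ (e + u)).reflection (e + u) = e + u :=
    Submodule.reflection_mem_subspace_eq_self (Submodule.mem_span_singleton_self _)
  have hsub : (𝕜 ∙ (e + u)).reflection (e - u) = -(e - u) := by
    refine Submodule.reflection_mem_subspace_orthogonalComplement_eq_neg ?_
    rw [Submodule.mem_orthogonal_singleton_iff_inner_right, inner_add_left, inner_sub_right,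
      inner_sub_right, inner_self_eq_norm_sq_to_K, inner_self_eq_norm_sq_to_K, hue,
      ← inner_conj_symm u e, hc, RCLike.conj_ofReal]
    ring
  have he : e = (2⁻¹ : 𝕜) • (e + u) + (2⁻¹ : 𝕜) • (e - u) := by module
  calc planeRotation 𝕜 e u e = (𝕜 ∙ (e + u)).reflection e := by
        rw [planeRotation, LinearIsometryEquiv.trans_apply,
          Submodule.reflection_mem_subspace_eq_self (Submodule.mem_span_singleton_self e)]
    _ = (2⁻¹ : 𝕜) • (e + u) + (2⁻¹ : 𝕜) • -(e - u) := by
        refine (congrArg _ he).trans ?_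
        rw [map_add, map_smul, map_smul, hadd, hsub]
    _ = u := by module

theorem norm_sq_planeRotation_sub_le {e u : E} (he : ‖e‖ = 1) (hu : ‖u‖ = 1) {c : ℝ}
    (hc : ⟪e, u⟫_𝕜 = c) (f : E) : ‖planeRotation 𝕜 e u f - f‖ ^ 2 ≤ 2 * (1 - c) * ‖f‖ ^ 2 := by
  have h := norm_sq_starProjection_sub_le (𝕜 ∙ e) (𝕜 ∙ (e + u))
    (fun _ => norm_sq_starProjection_orthogonal_span_le he hu hc)
    (fun _ => norm_sq_starProjection_span_le he hu hc) f
  rw [planeRotation, LinearIsometryEquiv.trans_apply, norm_reflection_reflection_sub, mul_pow]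
  linarith

end Rotation

section Preparation

theorem exists_isNearIdentity_mulVec_single_eq {Q : Type*} [Fintype Q] [DecidableEq Q]
    {u : EuclideanSpace ℂ Q} (hu : ‖u‖ = 1) {z : Q} {c : ℝ} (hc : u z = c) :
    ∃ U : Matrix Q Q ℂ, U *ᵥ Pi.single z 1 = u ∧
      IsNearIdentity (fun _ : Unit => 1) (fun _ => U) (2 * (1 - c)) := by
  set e : EuclideanSpace ℂ Q := EuclideanSpace.single z 1 with he
  have hnorm : ‖e‖ = 1 := by simp [he]
  have hinner : ⟪e, u⟫_ℂ = c := by simp [he, EuclideanSpace.inner_single_left, hc]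
  obtain ⟨U, hU, hUR⟩ := exists_mem_unitaryGroup_toEuclideanCLM_eq (planeRotation ℂ e u)
  refine ⟨U, ?_, ⟨fun _ => zero_le_one, by simp⟩, fun _ => hU, fun f => ?_⟩
  · have := hUR e
    rw [planeRotation_apply_self (hnorm.trans hu.symm) hinner] at this
    exact congrArg WithLp.ofLp this
  · simpa [hUR] using norm_sq_planeRotation_sub_le hnorm hu hinner f

theorem le_sqrt_of_mem_stdSimplex {ι : Type*} [Fintype ι] {p : ι → ℝ} (hp : p ∈ stdSimplex ℝ ι)
    (i : ι) : p i ≤ √(p i) :=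
  Real.le_sqrt_of_sq_le (pow_le_of_le_one (hp.1 i) (mem_Icc_of_mem_stdSimplex hp i).2 two_ne_zero)

variable {n : ℕ} [NeZero n] {p : Fin n → ℝ}

theorem exists_preparesQuantumSample (hp : p ∈ stdSimplex ℝ (Fin n)) :
    ∃ U, PreparesQuantumSample p U ∧
      IsNearIdentity (fun _ : Unit => 1) (fun _ => U) (2 * (1 - p 0)) := by
  have hnorm : ‖(WithLp.toLp 2 fun i => (√(p i) : ℂ) : EuclideanSpace ℂ (Fin n))‖ = 1 := by
    simp [EuclideanSpace.norm_eq, Real.sq_sqrt (hp.1 _), hp.2]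
  obtain ⟨U, hU, hnear⟩ := exists_isNearIdentity_mulVec_single_eq hnorm (z := 0) rfl
  exact ⟨U, hU, hnear.mono (by gcongr; exact le_sqrt_of_mem_stdSimplex hp 0)⟩

theorem exists_preparesPurification (hp : p ∈ stdSimplex ℝ (Fin n)) :
    ∃ U, PreparesPurification p U ∧
      IsNearIdentity (fun _ : Unit => 1) (fun _ => U) (2 * (1 - p 0)) := by
  set ψ : Fin n → EuclideanSpace ℂ (Fin n) := fun i => EuclideanSpace.single i 1 with hψ
  have hnorm : ‖(WithLp.toLp 2 fun x => (√(p x.2) : ℂ) * ψ x.2 x.1 :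
      EuclideanSpace ℂ (Fin n × Fin n))‖ = 1 := by
    simp [hψ, EuclideanSpace.norm_eq, Fintype.sum_prod_type, apply_ite norm,
      Real.sq_sqrt (hp.1 _), hp.2]
  obtain ⟨U, hU, hnear⟩ := exists_isNearIdentity_mulVec_single_eq hnorm (z := (0, 0))
    (c := √(p 0)) (by simp [hψ])
  exact ⟨U, ⟨ψ, EuclideanSpace.orthonormal_single, hU⟩,
    hnear.mono (by gcongr; exact le_sqrt_of_mem_stdSimplex hp 0)⟩

end Preparation

section Entropy

variable {n : ℕ}

theorem shannonEntropy_eq_sum_negMulLog (p : Fin n → ℝ) :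
    shannonEntropy p = (∑ i, Real.negMulLog (p i)) / Real.log 2 := by
  simp only [shannonEntropy, Real.logb, Real.negMulLog, sum_div, mul_div_assoc, neg_mul, neg_div,
    sum_neg_distrib]

theorem continuous_shannonEntropy : Continuous (shannonEntropy : (Fin n → ℝ) → ℝ) := by
  simp only [funext shannonEntropy_eq_sum_negMulLog]
  fun_prop

theorem concaveOn_shannonEntropy :
    ConcaveOn ℝ (Set.Ici 0) (shannonEntropy : (Fin n → ℝ) → ℝ) := by
  refine ⟨convex_Ici 0, fun p hp q hq a b ha hb hab => ?_⟩
  simp only [shannonEntropy_eq_sum_negMulLog, smul_eq_mul, ← mul_div_assoc, ← add_div, mul_sum,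
    ← sum_add_distrib]
  gcongr with i
  exact Real.concaveOn_negMulLog.2 (hp i) (hq i) ha hb hab

theorem shannonEntropy_single (i : Fin n) : shannonEntropy (Pi.single i 1) = 0 := by
  simp [shannonEntropy, Pi.single_apply]

theorem shannonEntropy_uniform [NeZero n] :
    shannonEntropy (fun _ : Fin n => (1 / n : ℝ)) = Real.logb 2 n := by
  simp [shannonEntropy, NeZero.ne n]

theorem shannonEntropy_two_point (x : ℝ) :
    shannonEntropy ![1 - x, x] = Real.binEntropy x / Real.log 2 := by
  rw [shannonEntropy_eq_sum_negMulLog, Real.binEntropy_eq_negMulLog_add_negMulLog_one_sub,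
    Fin.sum_univ_two, add_comm]
  rfl

/-- On the segment from a point mass to the uniform distribution the entropy grows at least
linearly, by concavity. -/
theorem exists_shannonEntropy_eq [NeZero n] {t b : ℝ} (ht : t ∈ Set.Icc (0 : ℝ) 1)
    (hb : b ∈ Set.Icc 0 (t * Real.logb 2 n)) :
    ∃ p ∈ stdSimplex ℝ (Fin n), 1 - p 0 ≤ t ∧ shannonEntropy p = b := by
  have hpoint : Pi.single 0 1 ∈ stdSimplex ℝ (Fin n) := single_mem_stdSimplex ℝ 0
  have huniform : (fun _ => (1 / n : ℝ)) ∈ stdSimplex ℝ (Fin n) := ⟨fun _ => by positivity, by simp⟩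
  set path : ℝ → Fin n → ℝ :=
    fun r => (1 - r) • Pi.single 0 1 + r • fun _ => (1 / n : ℝ) with hpath
  have hstart : shannonEntropy (path 0) = 0 := by simp [hpath, shannonEntropy_single]
  have hend : t * Real.logb 2 n ≤ shannonEntropy (path t) := by
    simpa [shannonEntropy_single, shannonEntropy_uniform, -one_div] using
      concaveOn_shannonEntropy.2 (Set.mem_Ici.2 hpoint.1) (Set.mem_Ici.2 huniform.1)
        (sub_nonneg.2 ht.2) ht.1 (sub_add_cancel 1 t)
  have hcont : Continuous fun r => shannonEntropy (path r) :=
    continuous_shannonEntropy.comp (by fun_prop)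
  obtain ⟨r, hr, hrb⟩ := intermediate_value_Icc ht.1 hcont.continuousOn
    ⟨hstart.trans_le hb.1, hb.2.trans hend⟩
  refine ⟨path r, convex_stdSimplex ℝ _ hpoint huniform (sub_nonneg.2 (hr.2.trans ht.2)) hr.1
    (sub_add_cancel 1 r), ?_, hrb⟩
  have : 0 ≤ r * (1 / n) := mul_nonneg hr.1 (by positivity)
  simp only [hpath, Pi.add_apply, Pi.smul_apply, Pi.single_eq_same, smul_eq_mul]
  linarith [hr.2]

/-- The lower bound `h(min(1, γ² / log n))` on the entropy in `Promise`. -/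
noncomputable def entropyThreshold (γ : ℝ) (n : ℕ) : ℝ :=
  shannonEntropy ![1 - min 1 (γ ^ 2 / Real.logb 2 n), min 1 (γ ^ 2 / Real.logb 2 n)]

theorem logb_two_natCast_nonneg (n : ℕ) : 0 ≤ Real.logb 2 n :=
  div_nonneg (Real.log_natCast_nonneg n) (Real.log_nonneg one_le_two)

theorem entropyThreshold_nonneg (γ : ℝ) (n : ℕ) : 0 ≤ entropyThreshold γ n := by
  have := logb_two_natCast_nonneg n
  rw [entropyThreshold, shannonEntropy_two_point]
  exact div_nonneg (Real.binEntropy_nonneg (by positivity) (min_le_left _ _))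
    (Real.log_nonneg one_le_two)

theorem entropyThreshold_le_one (γ : ℝ) (n : ℕ) : entropyThreshold γ n ≤ 1 := by
  rw [entropyThreshold, shannonEntropy_two_point]
  exact div_le_one_of_le₀ Real.binEntropy_le_log_two (Real.log_nonneg one_le_two)

theorem sq_mul_entropyThreshold_lt {γ : ℝ} (hγ : γ ≠ 0) (hn : 1 < n) :
    γ ^ 2 * entropyThreshold γ n <
      min 1 (2 * (γ ^ 2 / Real.logb 2 n)) * Real.logb 2 n := by
  have hL : 0 < Real.logb 2 n := Real.logb_pos one_lt_two (by exact_mod_cast hn)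
  have hγ2 : 0 < γ ^ 2 := by positivity
  have hle : γ ^ 2 * entropyThreshold γ n ≤ γ ^ 2 :=
    mul_le_of_le_one_right hγ2.le (entropyThreshold_le_one γ n)
  rw [min_mul_of_nonneg _ _ hL.le, one_mul, mul_assoc, div_mul_cancel₀ _ hL.ne']
  refine lt_min ?_ (by linarith)
  rcases lt_or_ge (γ ^ 2) (Real.logb 2 n) with h | h
  · exact hle.trans_lt h
  · rw [entropyThreshold, min_eq_left ((one_le_div hL).2 h), shannonEntropy_two_point]
    simpa using hL

/-- Two distributions that satisfy the promise for the factor `γ`, whose entropies no single number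
estimates to within that factor, and that are both within `O(γ² / log n)` of the point mass at
`0`. All inequalities are strict, so that the pair can be perturbed. -/
structure IsHardPair [NeZero n] (γ : ℝ) (p q : Fin n → ℝ) : Prop where
  mem_left : p ∈ stdSimplex ℝ (Fin n)
  mem_right : q ∈ stdSimplex ℝ (Fin n)
  threshold_lt : entropyThreshold γ n < shannonEntropy p
  sq_mul_lt : γ ^ 2 * shannonEntropy p < shannonEntropy q
  one_sub_left_lt : 1 - p 0 < 4 * (γ ^ 2 / Real.logb 2 n)
  one_sub_right_lt : 1 - q 0 < 4 * (γ ^ 2 / Real.logb 2 n)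

theorem exists_isHardPair [NeZero n] (hn : 1 < n) {γ : ℝ} (hγ : 1 < γ) :
    ∃ p q : Fin n → ℝ, IsHardPair γ p q := by
  have hL : 0 < Real.logb 2 n := Real.logb_pos one_lt_two (by exact_mod_cast hn)
  have hγ2 : 1 < γ ^ 2 := one_lt_pow₀ hγ two_ne_zero
  have hε : 0 < γ ^ 2 / Real.logb 2 n := by positivity
  set t := min 1 (2 * (γ ^ 2 / Real.logb 2 n))
  have ht01 : t ∈ Set.Icc (0 : ℝ) 1 := ⟨by positivity, min_le_left _ _⟩
  have htL : 0 ≤ t * Real.logb 2 n := mul_nonneg ht01.1 hL.le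
  have htε : t < 4 * (γ ^ 2 / Real.logb 2 n) := (min_le_right _ _).trans_lt (by linarith)
  obtain ⟨b, hb, hbt⟩ : ∃ b, entropyThreshold γ n < b ∧ b < t * Real.logb 2 n / γ ^ 2 :=
    exists_between
      ((lt_div_iff₀' (by positivity)).2 (sq_mul_entropyThreshold_lt (by positivity) hn))
  obtain ⟨p, hp, hp0, hpH⟩ := exists_shannonEntropy_eq ht01
    ⟨(entropyThreshold_nonneg γ n).trans hb.le, hbt.le.trans (div_le_self htL hγ2.le)⟩
  obtain ⟨q, hq, hq0, hqH⟩ := exists_shannonEntropy_eq ht01 (Set.right_mem_Icc.2 htL)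
  refine ⟨p, q, hp, hq, hpH ▸ hb, ?_, hp0.trans_lt htε, hq0.trans_lt htε⟩
  rwa [hpH, hqH, ← lt_div_iff₀' (by positivity)]

namespace IsHardPair

variable [NeZero n] {γ : ℝ} {p q : Fin n → ℝ}

theorem promise_left (h : IsHardPair γ p q) : Promise γ p :=
  ⟨(entropyThreshold_nonneg γ n).trans_lt h.threshold_lt, h.threshold_lt.le⟩

theorem promise_right (h : IsHardPair γ p q) (hγ : 1 ≤ γ) : Promise γ q := by
  have hpq : shannonEntropy p ≤ shannonEntropy q :=
    (le_mul_of_one_le_left h.promise_left.1.le (one_le_pow₀ hγ)).trans h.sq_mul_lt.le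
  exact ⟨h.promise_left.1.trans_le hpq, h.promise_left.2.trans hpq⟩

theorem eventually {α : Type*} {l : Filter α} {f g : α → Fin n → ℝ} (h : IsHardPair γ p q)
    (hf : Tendsto f l (𝓝 p)) (hg : Tendsto g l (𝓝 q))
    (hfmem : ∀ᶠ a in l, f a ∈ stdSimplex ℝ (Fin n))
    (hgmem : ∀ᶠ a in l, g a ∈ stdSimplex ℝ (Fin n)) : ∀ᶠ a in l, IsHardPair γ (f a) (g a) := by
  have hHf := (continuous_shannonEntropy.tendsto p).comp hf
  have hHg := (continuous_shannonEntropy.tendsto q).comp hg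
  filter_upwards [hfmem, hgmem, hHf.eventually_const_lt h.threshold_lt,
    (hHf.const_mul (γ ^ 2)).eventually_lt hHg h.sq_mul_lt,
    ((tendsto_pi_nhds.1 hf 0).const_sub 1).eventually_lt_const h.one_sub_left_lt,
    ((tendsto_pi_nhds.1 hg 0).const_sub 1).eventually_lt_const h.one_sub_right_lt]
    with a h₁ h₂ h₃ h₄ h₅ h₆
  exact ⟨h₁, h₂, h₃, h₄, h₅, h₆⟩

end IsHardPair

end Entropy

section Density

theorem exists_le_card_fiber {ι κ : Type*} [Fintype ι] [Fintype κ] [DecidableEq κ] [Nonempty κ]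
    {c : κ → ℕ} (hc : ∑ i, c i ≤ Fintype.card ι) : ∃ v : ι → κ, ∀ i, c i ≤ #{j | v j = i} := by
  obtain ⟨e⟩ : Nonempty ((Σ i, Fin (c i)) ↪ ι) :=
    Function.Embedding.nonempty_of_card_le (by simpa using hc)
  refine ⟨Function.extend e Sigma.fst (Classical.arbitrary _), fun i => ?_⟩
  calc c i = #(univ.map ((Function.Embedding.sigmaMk i).trans e)) := by simp
    _ ≤ _ := card_le_card fun j hj => by
      obtain ⟨a, -, rfl⟩ := mem_map.1 hj
      simp [e.injective.extend_apply]

theorem tendsto_of_le_of_tendsto_sum {α ι : Type*} [Fintype ι] {l : Filter α} {a f : α → ι → ℝ}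
    {p : ι → ℝ} (ha : Tendsto a l (𝓝 p)) (haf : ∀ x, a x ≤ f x)
    (hf : Tendsto (fun x => ∑ i, f x i) l (𝓝 (∑ i, p i))) : Tendsto f l (𝓝 p) := by
  rw [tendsto_pi_nhds] at ha ⊢
  intro i
  have hupper : Tendsto (fun x => a x i + (∑ k, f x k - ∑ k, a x k)) l (𝓝 (p i)) := by
    simpa using (ha i).add (hf.sub (tendsto_finsetSum univ fun k _ => ha k))
  refine tendsto_of_tendsto_of_tendsto_of_le_of_le (ha i) hupper (fun x => haf x i) fun x => ?_
  rw [← sub_le_iff_le_add', ← sum_sub_distrib]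
  exact single_le_sum (f := fun k => f x k - a x k) (fun k _ => sub_nonneg.2 (haf x k))
    (mem_univ i)

variable {n : ℕ} [NeZero n]

theorem exists_tendsto_frequency {p : Fin n → ℝ} (hp : p ∈ stdSimplex ℝ (Fin n)) :
    ∃ v : ∀ m : ℕ, Fin m → Fin n, Tendsto (fun m => frequency (v m)) atTop (𝓝 p) := by
  have hfloor (m : ℕ) : ∑ i, ⌊p i * m⌋₊ ≤ Fintype.card (Fin m) := by
    rw [Fintype.card_fin, ← Nat.cast_le (α := ℝ), Nat.cast_sum]
    calc ∑ i, (⌊p i * m⌋₊ : ℝ) ≤ ∑ i, p i * m :=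
          sum_le_sum fun i _ => Nat.floor_le (mul_nonneg (hp.1 i) m.cast_nonneg)
      _ = m := by rw [← sum_mul, hp.2, one_mul]
  choose v hv using fun m => exists_le_card_fiber (hfloor m)
  refine ⟨v, tendsto_of_le_of_tendsto_sum (a := fun (m : ℕ) i => ⌊p i * m⌋₊ / m)
    (tendsto_pi_nhds.2 fun i => (tendsto_nat_floor_mul_div_atTop (hp.1 i)).comp
      tendsto_natCast_atTop_atTop) (fun m i => ?_) (tendsto_const_nhds.congr' ?_)⟩
  · exact div_le_div_of_nonneg_right (Nat.cast_le.2 (hv m i)) m.cast_nonneg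
  · filter_upwards [eventually_ne_atTop 0] with m hm
    have : NeZero m := ⟨hm⟩
    rw [(frequency_mem_stdSimplex (v m)).2, hp.2]

theorem eventually_exists_isHardPair_frequency (hn : 1 < n) {γ : ℝ} (hγ : 1 < γ) :
    ∀ᶠ m in atTop, ∃ v w : Fin m → Fin n, IsHardPair γ (frequency v) (frequency w) := by
  obtain ⟨p, q, h⟩ := exists_isHardPair hn hγ
  obtain ⟨v, hv⟩ := exists_tendsto_frequency h.mem_left
  obtain ⟨w, hw⟩ := exists_tendsto_frequency h.mem_right
  have hmem (u : ∀ m : ℕ, Fin m → Fin n) :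
      ∀ᶠ m in atTop, frequency (u m) ∈ stdSimplex ℝ (Fin n) := by
    filter_upwards [eventually_ne_atTop 0] with m hm
    have : NeZero m := ⟨hm⟩
    exact frequency_mem_stdSimplex (u m)
  exact (h.eventually hv hw (hmem v) (hmem w)).mono fun m hm => ⟨v m, w m, hm⟩

end Density

section QueryLowerBounds

theorem mul_sqrt_div_le_of_two_mul_le {s L γ T : ℝ} (hL : 0 < L) (hγ : 0 < γ)
    (h : 2 * s ≤ 1 + 4 * (T * √(16 * (γ ^ 2 / L)))) : (2 * s - 1) / 16 * (√L / γ) ≤ T := by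
  have hsqrt : √(16 * (γ ^ 2 / L)) = 4 * (γ / √L) := by
    rw [show 16 * (γ ^ 2 / L) = (4 * γ) ^ 2 / L by ring, Real.sqrt_div' _ hL.le,
      Real.sqrt_sq (by positivity), mul_div_assoc]
  have hLs : 0 < √L := Real.sqrt_pos.2 hL
  rw [hsqrt] at h
  calc (2 * s - 1) / 16 * (√L / γ) ≤ (4 * (T * (4 * (γ / √L)))) / 16 * (√L / γ) := by
        gcongr
        linarith
    _ = T := by
        field_simp
        ring

namespace IsHardPair

variable {m n : ℕ} [NeZero n] {γ s : ℝ}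

section Distributions

variable {p q : Fin n → ℝ}

theorem le_queries_of_isNearIdentity (h : IsHardPair γ p q) (hγ : 0 < γ) {Q ι κ : Type}
    [Fintype Q] [DecidableEq Q] [Fintype ι] [Fintype κ] {w : ι → ℝ} {w' : κ → ℝ}
    {U : ι → Matrix Q Q ℂ} {V : κ → Matrix Q Q ℂ} (hU : IsNearIdentity w U (4 * (1 - p 0)))
    (hV : IsNearIdentity w' V (4 * (1 - q 0))) (A : QueryAlgorithm Q)
    (hp : s ≤ ∑ i, w i * A.estimateProb (U i) γ (shannonEntropy p))
    (hq : s ≤ ∑ i, w' i * A.estimateProb (V i) γ (shannonEntropy q)) :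
    (2 * s - 1) / 16 * (√(Real.logb 2 n) / γ) ≤ A.queries := by
  have hp0 : p 0 ≤ 1 := (mem_Icc_of_mem_stdSimplex h.mem_left 0).2
  have hL : 0 < Real.logb 2 n := by
    refine (logb_two_natCast_nonneg n).lt_of_ne fun hL => ?_
    have := h.one_sub_left_lt
    rw [← hL, div_zero] at this
    linarith
  exact mul_sqrt_div_le_of_two_mul_le hL hγ (IsNearIdentity.two_mul_le_of_le_sum_estimateProb
    (hU.mono (by linarith [h.one_sub_left_lt])) (hV.mono (by linarith [h.one_sub_right_lt]))
    A hγ h.sq_mul_lt hp hq)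

theorem le_queries_of_estimatesFromSampleList (h : IsHardPair γ p q) (hγ : 1 ≤ γ)
    {A : QueryAlgorithm (Fin m × Fin n)} (hA : EstimatesFromSampleList A γ s) :
    (2 * s - 1) / 16 * (√(Real.logb 2 n) / γ) ≤ A.queries :=
  h.le_queries_of_isNearIdentity (by positivity) (isNearIdentity_sampleList h.mem_left)
    (isNearIdentity_sampleList h.mem_right) A (hA p h.mem_left h.promise_left)
    (hA q h.mem_right (h.promise_right hγ))

theorem le_queries_of_estimatesFromQuantumSamples (h : IsHardPair γ p q) (hγ : 1 ≤ γ)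
    {A : QueryAlgorithm (Fin n)} (hA : EstimatesFromQuantumSamples A γ s) :
    (2 * s - 1) / 16 * (√(Real.logb 2 n) / γ) ≤ A.queries := by
  obtain ⟨U, hU, hUnear⟩ := exists_preparesQuantumSample h.mem_left
  obtain ⟨V, hV, hVnear⟩ := exists_preparesQuantumSample h.mem_right
  have hp0 : p 0 ≤ 1 := (mem_Icc_of_mem_stdSimplex h.mem_left 0).2
  have hq0 : q 0 ≤ 1 := (mem_Icc_of_mem_stdSimplex h.mem_right 0).2
  refine h.le_queries_of_isNearIdentity (by positivity) (hUnear.mono (by linarith))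
    (hVnear.mono (by linarith)) A ?_ ?_
  · simpa using hA p h.mem_left h.promise_left U (hUnear.unitary ()) hU
  · simpa using hA q h.mem_right (h.promise_right hγ) V (hVnear.unitary ()) hV

theorem le_queries_of_estimatesFromPurification (h : IsHardPair γ p q) (hγ : 1 ≤ γ)
    {A : QueryAlgorithm (Fin n × Fin n)} (hA : EstimatesFromPurification A γ s) :
    (2 * s - 1) / 16 * (√(Real.logb 2 n) / γ) ≤ A.queries := by
  obtain ⟨U, hU, hUnear⟩ := exists_preparesPurification h.mem_left
  obtain ⟨V, hV, hVnear⟩ := exists_preparesPurification h.mem_right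
  have hp0 : p 0 ≤ 1 := (mem_Icc_of_mem_stdSimplex h.mem_left 0).2
  have hq0 : q 0 ≤ 1 := (mem_Icc_of_mem_stdSimplex h.mem_right 0).2
  refine h.le_queries_of_isNearIdentity (by positivity) (hUnear.mono (by linarith))
    (hVnear.mono (by linarith)) A ?_ ?_
  · simpa using hA p h.mem_left h.promise_left U (hUnear.unitary ()) hU
  · simpa using hA q h.mem_right (h.promise_right hγ) V (hVnear.unitary ()) hV

end Distributions

theorem le_queries_of_estimatesFromFrequencyVector [NeZero m] {v w : Fin m → Fin n}
    (h : IsHardPair γ (frequency v) (frequency w)) (hγ : 1 ≤ γ)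
    {A : QueryAlgorithm (Fin m × Fin n)} (hA : EstimatesFromFrequencyVector A γ s) :
    (2 * s - 1) / 16 * (√(Real.logb 2 n) / γ) ≤ A.queries := by
  have average (u : Fin m → Fin n) (hu : Promise γ (frequency u)) : s ≤ ∑ r : Fin m, (1 / m : ℝ) *
      A.estimateProb (stringOracle (u ∘ Equiv.addRight r)) γ (shannonEntropy (frequency u)) := by
    calc s = ∑ _r : Fin m, (1 / m : ℝ) * s := by simp [NeZero.ne m]
      _ ≤ _ := by
        gcongr with r
        simpa only [frequency_comp_equiv, hu, true_implies] using hA (u ∘ Equiv.addRight r)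
  exact h.le_queries_of_isNearIdentity (by positivity) (isNearIdentity_shift v)
    (isNearIdentity_shift w) A (average v h.promise_left) (average w (h.promise_right hγ))

end IsHardPair

end QueryLowerBounds

theorem mainTheorem6 (s : ℝ) (hs : 1 / 2 < s) :
    ∃ c : ℝ, 0 < c ∧ ∀ (n : ℕ) [NeZero n] (γ : ℝ), 1 < γ →
      (∃ m₀ : ℕ, ∀ m : ℕ, m₀ ≤ m → ∀ A : QueryAlgorithm (Fin m × Fin n),
        EstimatesFromFrequencyVector A γ s → c * (√(Real.logb 2 n) / γ) ≤ A.queries) ∧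
      (∀ (m : ℕ) (A : QueryAlgorithm (Fin m × Fin n)),
        EstimatesFromSampleList A γ s → c * (√(Real.logb 2 n) / γ) ≤ A.queries) ∧
      (∀ A : QueryAlgorithm (Fin n),
        EstimatesFromQuantumSamples A γ s → c * (√(Real.logb 2 n) / γ) ≤ A.queries) ∧
      (∀ A : QueryAlgorithm (Fin n × Fin n),
        EstimatesFromPurification A γ s → c * (√(Real.logb 2 n) / γ) ≤ A.queries) := by
  refine ⟨(2 * s - 1) / 16, by linarith, fun n _ γ hγ => ?_⟩
  rcases (NeZero.one_le (n := n)).eq_or_lt with rfl | hn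
  · simp
  obtain ⟨p, q, hpq⟩ := exists_isHardPair hn hγ
  obtain ⟨m₀, hm₀⟩ := eventually_atTop.1
    ((eventually_exists_isHardPair_frequency hn hγ).and (eventually_ne_atTop 0))
  refine ⟨⟨m₀, fun m hm A hA => ?_⟩, fun _ _ hA => ?_, fun _ hA => ?_, fun _ hA => ?_⟩
  · obtain ⟨⟨v, w, hvw⟩, hm0⟩ := hm₀ m hm
    have : NeZero m := ⟨hm0⟩
    exact hvw.le_queries_of_estimatesFromFrequencyVector hγ.le hA
  · exact hpq.le_queries_of_estimatesFromSampleList hγ.le hA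
  · exact hpq.le_queries_of_estimatesFromQuantumSamples hγ.le hA
  · exact hpq.le_queries_of_estimatesFromPurification hγ.le hA
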